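/- For integers $A,B$ let ${A \brack B}_q=\dfrac{(q)_A}{(q)_B\,(q)_{A-B}}$ if $B\ge 0$ and $A-B\ge 0$, and ${A\brack B}_q=0$ otherwise, where $(q)_m=\prod_{j=1}^{m}(1-q^j)$. For integers $N,M$, a positive integer $K$ and rational numbers $\alpha,\beta$ put $$G(N,M,\alpha,\beta,K,q)=\sum_{j=-\infty}^{\infty}(-1)^j q^{Kj\frac{(\alpha+\beta)j+(\alpha-\beta)}{2}}{N+M\brack N-Kj}_q ,$$ a finite sum. Write $P(q)\ge 0$ if $P(q)$ is a polynomial in $q$ all of whose coefficients are nonnegative. **Theorem.** Let $v\ge 2$ and $n\ge 2$ be integers and let $L\ge 0$ be an integer. Then $$G\Bigl(L-2^{n-2},\,L+2^{n-2},\,2v\,\tfrac{2^n-2^{-n}}{3}+\tfrac{2^n+2^{1-n}}{3},\,2v\,\tfrac{2^n-2^{-n}}{3}+\tfrac{2^{2-n}-2^n}{3},\,2^n v,\,q\Bigr)\ \ge\ 0 .$$ Equivalently, written out, $$\sum_{j=-\infty}^{\infty}(-1)^j q^{v\left(2\frac{4^n-1}{3}v+1\right)j^2+\frac{4^n-1}{3}vj}{2L\brack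 L-2^{n-2}-2^n v j}_q\ \ge\ 0 .$$ -/

import Mathlib

open Polynomial

namespace BressoudPos

/-- The `q`-shifted factorial `(q)_n = ∏_{j=1}^n (1 - q^j)`, a polynomial in `q = X`. -/
noncomputable def qPoch (n : ℕ) : ℤ[X] :=
  ∏ j ∈ Finset.range n, (1 - X ^ (j + 1))

/-- The Gaussian polynomial with natural entries, through the `q`-Pascal rule.  It equals the
quotient `(q)_{n+m} / ((q)_n (q)_m)`: see `qChoose_mul_qPoch`. -/
noncomputable def qChoose : ℕ → ℕ → ℤ[X]
  | _, 0 => 1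
  | 0, _ + 1 => 0
  | n + 1, k + 1 => qChoose n k + X ^ (k + 1) * qChoose n (k + 1)

theorem qChoose_eq_zero : ∀ {n k : ℕ}, n < k → qChoose n k = 0
  | _, 0, h => absurd h (Nat.not_lt_zero _)
  | 0, _ + 1, _ => by rw [qChoose]
  | n + 1, k + 1, h => by
      rw [qChoose, qChoose_eq_zero (show n < k by omega),
        qChoose_eq_zero (show n < k + 1 by omega)]
      simp

theorem qChoose_self : ∀ n : ℕ, qChoose n n = 1
  | 0 => by rw [qChoose]
  | n + 1 => by
      rw [qChoose, qChoose_self n, qChoose_eq_zero (Nat.lt_succ_self n)]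
      simp

/-- The Gaussian polynomial is the quotient `(q)_{n+m} / ((q)_n (q)_m)`. -/
theorem qChoose_mul_qPoch : ∀ n m : ℕ,
    qChoose (n + m) n * (qPoch n * qPoch m) = qPoch (n + m)
  | 0, m => by simp [qChoose, qPoch]
  | n + 1, 0 => by simp [qChoose_self, qPoch]
  | n + 1, m + 1 => by
      have h1 := qChoose_mul_qPoch n (m + 1)
      have h2 := qChoose_mul_qPoch (n + 1) m
      have e1 : n + 1 + m = n + (m + 1) := by omega
      have e2 : n + 1 + (m + 1) = n + (m + 1) + 1 := by omega
      rw [e1] at h2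
      rw [e2, qChoose]
      have p : ∀ k, qPoch (k + 1) = qPoch k * (1 - X ^ (k + 1)) := fun k => by
        simp [qPoch, Finset.prod_range_succ]
      rw [p (n + (m + 1)), p n]
      rw [p n] at h2
      rw [p m] at h1 ⊢
      linear_combination (1 - X ^ (n + 1)) * h1 + X ^ (n + 1) * (1 - X ^ (m + 1)) * h2

/-- The `q`-binomial coefficient with top entry `A` and bottom entry `B` in `ℤ`: it is
`(q)_A / ((q)_B (q)_{A-B})` if `B ≥ 0` and `A - B ≥ 0`, and `0` otherwise. -/
noncomputable def qBinom (A B : ℤ) : ℤ[X] :=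
  if 0 ≤ B ∧ 0 ≤ A - B then qChoose A.toNat B.toNat else 0

/-- Finite formal `ℤ`-linear combinations of powers `q^e` with rational exponents `e`.  This is
where a sum is formed before its exponents are known to be natural numbers. -/
abbrev QExp : Type := AddMonoidAlgebra ℤ ℚ

/-- The power `q^e` with rational exponent `e`. -/
noncomputable def qPow (e : ℚ) : QExp := AddMonoidAlgebra.single e 1

/-- A polynomial in `q`, read as a combination of powers of `q`. -/
noncomputable def ofPoly : ℤ[X] →ₐ[ℤ] QExp := Polynomial.aeval (qPow 1)

/-- `P ≥ 0`: the expression `P` is a polynomial in `q` all of whose coefficients are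
nonnegative. -/
def NonnegCoeffs (P : QExp) : Prop :=
  ∃ p : ℤ[X], (∀ k : ℕ, 0 ≤ p.coeff k) ∧ ofPoly p = P

/-- The Bressoud polynomial
`G(N,M,α,β,K,q) = ∑_{j ∈ ℤ} (-1)^j q^{K j ((α+β) j + (α-β)) / 2} [N+M, N-Kj]_q`.
For `K > 0` only finitely many terms are nonzero: see `finite_support_qBinom`. -/
noncomputable def G (N M : ℤ) (α β : ℚ) (K : ℕ) : QExp :=
  ∑ᶠ j : ℤ, ((j.negOnePow : ℤ) : QExp) *
    qPow ((K : ℚ) * j * (((α + β) * j + (α - β)) / 2)) * ofPoly (qBinom (N + M) (N - K * j))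

theorem finite_support_qBinom (A B : ℤ) (K : ℕ) (hK : 0 < K) (f : ℤ → QExp) :
    (Function.support fun j : ℤ => f j * ofPoly (qBinom A (B - K * j))).Finite := by
  refine (Set.finite_Icc (-(|A| + |B|)) (|A| + |B|)).subset fun j hj => ?_
  have h : 0 ≤ B - K * j ∧ 0 ≤ A - (B - K * j) := by
    by_contra h
    exact hj (by simp only [qBinom, if_neg h, map_zero, mul_zero])
  have hK' : (1 : ℤ) ≤ K := by exact_mod_cast hK
  have hA := le_abs_self A
  have hA0 := abs_nonneg A
  have hB := le_abs_self B
  have hB' := neg_abs_le B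
  have hB0 := abs_nonneg B
  constructor <;> nlinarith [h.1, h.2]

end BressoudPos

/-!
Write `[A, B]` for the Gaussian polynomial. The proof doubles lower entries repeatedly, by means of
an expansion with nonnegative coefficients, starting from Bressoud polynomials with integer
parameters `α` and `β`.

*Doubling* (`qb_doubling`). For `d = 0` or `1`, the product `q^{2k(k+d)} [2L, L-2k-d]` is a
combination of the `[2n+d, n-k]` whose coefficients are nonnegative and do not depend on `k`. The
`q`-Chu–Vandermonde sum gives
`q^{k(k+d)} [2L, L-2k-d] = ∑_m q^{m(m+d)} [L, m-k] [L, m+k+d]`. In each product on the right the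
factor `[L, m-k]` is expanded by the same sum over a splitting of `L` into `m+k+d` and `L-m-k-d`,
and a rearrangement of `q`-multinomial coefficients leaves `k` only in `[2n+d, n-k]`
(`qb_mul_qb_eq_finsum`). Summing with alternating signs over `k = c + K j`, the positivity of
`∑_j (-1)^j q^{e(j)} [2n+d, n-c-Kj]` for all `n` implies that of
`∑_j (-1)^j q^{e(j)+2k(k+d)} [2L, L-2c-d-2Kj]` for all `L` (`altSum_doubling_mem_nonneg`).

*Start* (`G_mem_nonneg`). For integers `α, β ≥ 0` with `1 ≤ α + β ≤ 2K - 1` and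
`β - K ≤ N - M ≤ K - α`, the polynomial `G(N, M, α, β, K)` is nonnegative, by induction on `N + M`
through the two `q`-Pascal rules. On the edges of this region which both rules would leave, the
sum is antisymmetric and vanishes (`G_eq_zero`).

With `K = 2v`, `α = v + 1`, `β = v`, `N = L`, `M = L + 1`, one doubling with `d = 1` gives the case
`n = 2`, and each further doubling with `d = 0` replaces `n` by `n + 1`, up to a constant power of
`q` (`altSum_hierExp_mem_nonneg`). Nonnegativity of coefficients is tracked among combinations of
powers `q^e` with `e ∈ ℚ`, where such constant powers are harmless; that the final sum is a
polynomial follows from its exponents being natural numbers (`hierExp_eq_natCast`).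
-/

namespace BressoudPos

/-! ### Combinations of powers of `q` with nonnegative coefficients -/

/-- The combinations of powers of `q` with rational exponents all of whose coefficients are
nonnegative, encoded as the image of the combinations with coefficients in `ℕ`, so that closure
under sums and products comes for free. -/
noncomputable def nonneg : Subsemiring QExp :=
  (AddMonoidAlgebra.mapRingHom ℚ (Nat.castRingHom ℤ)).rangeS

theorem coeff_nonneg_of_mem_nonneg {P : QExp} (hP : P ∈ nonneg) (e : ℚ) : 0 ≤ P.coeff e := by
  obtain ⟨p, rfl⟩ := hP
  simp

theorem qPow_mem_nonneg (e : ℚ) : qPow e ∈ nonneg :=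
  ⟨AddMonoidAlgebra.single e 1, by simp [qPow]⟩

theorem qPow_add (a b : ℚ) : qPow (a + b) = qPow a * qPow b := by
  simp [qPow, AddMonoidAlgebra.single_mul_single]

theorem qPow_zero : qPow 0 = 1 := rfl

theorem qPow_natCast (k : ℕ) : qPow k = qPow 1 ^ k := by
  simp [qPow, AddMonoidAlgebra.single_pow]

theorem ofPoly_X_pow (k : ℕ) : ofPoly (X ^ k) = qPow k := by
  simp [ofPoly, qPow_natCast]

theorem ofPoly_eq_sum (p : ℤ[X]) :
    ofPoly p = ∑ i ∈ p.support, AddMonoidAlgebra.single (i : ℚ) (p.coeff i) := by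
  rw [ofPoly, Polynomial.aeval_eq_sum_range' (n := p.natDegree + 1) (Nat.lt_succ_self _)]
  symm
  apply Finset.sum_subset_zero_on_sdiff
  · intro i hi
    simpa [Nat.lt_succ_iff] using Polynomial.le_natDegree_of_mem_supp i hi
  · intro i hi
    simp only [Finset.mem_sdiff, Polynomial.mem_support_iff, not_not] at hi
    simp [hi.2]
  · intro i _
    rw [← qPow_natCast]
    simp [qPow, AddMonoidAlgebra.smul_single]

theorem coeff_ofPoly (p : ℤ[X]) (k : ℕ) : (ofPoly p).coeff (k : ℚ) = p.coeff k := by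
  rw [ofPoly_eq_sum, AddMonoidAlgebra.coeff_sum, Finsupp.finsetSum_apply]
  simp [AddMonoidAlgebra.coeff_single, Finsupp.single_apply]
  exact fun h => h.symm

/-- Nonnegativity of the coefficients may be checked among combinations with rational exponents,
provided that the combination is a polynomial. -/
theorem nonnegCoeffs_of_mem {P : QExp} (h : P ∈ nonneg) (hr : P ∈ ofPoly.range) :
    NonnegCoeffs P := by
  obtain ⟨p, rfl⟩ := hr
  refine ⟨p, fun k => ?_, rfl⟩
  rw [← coeff_ofPoly]
  exact coeff_nonneg_of_mem_nonneg h _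

/-! ### Gaussian polynomials with integer entries -/

/-- The Gaussian polynomial with integer entries, as a combination of powers of `q` with rational
exponents. -/
noncomputable def qb (A B : ℤ) : QExp := ofPoly (qBinom A B)

theorem qb_eq_zero {A B : ℤ} (h : ¬(0 ≤ B ∧ B ≤ A)) : qb A B = 0 := by
  rw [qb, qBinom, if_neg (by omega), map_zero]

theorem qb_natCast (A B : ℕ) : qb A B = ofPoly (qChoose A B) := by
  by_cases h : B ≤ A
  · rw [qb, qBinom, if_pos (by omega)]; simp
  · rw [qb_eq_zero (by omega), qChoose_eq_zero (by omega), map_zero]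

theorem qb_zero_zero : qb 0 0 = 1 := by
  have := qb_natCast 0 0
  rw [qChoose_self, map_one] at this
  exact_mod_cast this

theorem qb_pascal {A : ℤ} (hA : 1 ≤ A) (B : ℤ) :
    qb A B = qb (A - 1) (B - 1) + qPow B * qb (A - 1) B := by
  rcases lt_trichotomy B 0 with hB | rfl | hB
  · rw [qb_eq_zero (by omega), qb_eq_zero (by omega), qb_eq_zero (by omega)]; simp
  · obtain ⟨a, rfl⟩ : ∃ a : ℕ, A = a + 1 := ⟨(A - 1).toNat, by omega⟩
    rw [qb_eq_zero (B := 0 - 1) (by omega)]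
    have h1 := qb_natCast (a + 1) 0
    have h2 := qb_natCast a 0
    simp only [qChoose] at h1 h2
    push_cast at h1 h2
    simp [h1, h2, qPow_zero]
  · obtain ⟨a, rfl⟩ : ∃ a : ℕ, A = a + 1 := ⟨(A - 1).toNat, by omega⟩
    obtain ⟨b, rfl⟩ : ∃ b : ℕ, B = b + 1 := ⟨(B - 1).toNat, by omega⟩
    have h1 := qb_natCast (a + 1) (b + 1)
    have h2 := qb_natCast a b
    have h3 := qb_natCast a (b + 1)
    have h4 := ofPoly_X_pow (b + 1)
    push_cast at h1 h2 h3 h4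
    rw [h1, add_sub_cancel_right, add_sub_cancel_right, h2, h3, qChoose, map_add, map_mul, h4]
    push_cast
    rfl

theorem qChoose_mem_nonneg (A B : ℕ) : ofPoly (qChoose A B) ∈ nonneg := by
  induction A generalizing B with
  | zero => cases B <;> simp [qChoose, one_mem, zero_mem]
  | succ a ih =>
    cases B with
    | zero => simp [qChoose, one_mem]
    | succ b =>
      rw [qChoose, map_add, map_mul, ofPoly_X_pow]
      exact add_mem (ih b) (mul_mem (qPow_mem_nonneg _) (ih _))

theorem qb_mem_nonneg (A B : ℤ) : qb A B ∈ nonneg := by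
  rw [qb, qBinom]
  split_ifs
  · exact qChoose_mem_nonneg _ _
  · simp [zero_mem]

theorem qPoch_ne_zero (n : ℕ) : qPoch n ≠ 0 := by
  refine Finset.prod_ne_zero_iff.2 fun j _ h => ?_
  have := congrArg (fun p => Polynomial.coeff p 0) h
  simp at this

theorem qChoose_symm (a b : ℕ) : qChoose (a + b) a = qChoose (a + b) b := by
  refine mul_right_cancel₀ (mul_ne_zero (qPoch_ne_zero a) (qPoch_ne_zero b)) ?_
  rw [qChoose_mul_qPoch, add_comm a b, mul_comm (qPoch a), qChoose_mul_qPoch]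

theorem qb_symm (A B : ℤ) : qb A (A - B) = qb A B := by
  by_cases h : 0 ≤ B ∧ B ≤ A
  · obtain ⟨b, rfl⟩ : ∃ b : ℕ, B = b := ⟨B.toNat, by omega⟩
    obtain ⟨a, rfl⟩ : ∃ a : ℕ, A = a + b := ⟨(A - b).toNat, by omega⟩
    have h1 := qb_natCast (a + b) a
    have h2 := qb_natCast (a + b) b
    push_cast at h1 h2
    rw [add_sub_cancel_right, h1, h2, qChoose_symm]
  · rw [qb_eq_zero h, qb_eq_zero (by omega)]

/-- Two ways of writing the `q`-multinomial coefficient `(q)_{a+b+c+d} / ((q)_a (q)_b (q)_c (q)_d)`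
as a product of Gaussian polynomials. -/
theorem qb_multinomial (a b c d : ℤ) :
    qb (a + b + c + d) (a + b) * qb (a + b) a * qb (c + d) c =
      qb (a + b + c + d) (b + c) * qb (a + d) a * qb (b + c) c := by
  by_cases h : 0 ≤ a ∧ 0 ≤ b ∧ 0 ≤ c ∧ 0 ≤ d
  · obtain ⟨ha, hb, hc, hd⟩ := h
    lift a to ℕ using ha
    lift b to ℕ using hb
    lift c to ℕ using hc
    lift d to ℕ using hd
    have key : qChoose (a + b + c + d) (a + b) * qChoose (a + b) a * qChoose (c + d) c =
        qChoose (a + b + c + d) (b + c) * qChoose (a + d) a * qChoose (b + c) c := by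
      have h1 := qChoose_mul_qPoch (a + b) (c + d)
      have h2 := qChoose_mul_qPoch a b
      have h3 := qChoose_mul_qPoch c d
      have h4 := qChoose_mul_qPoch (b + c) (a + d)
      have h5 := qChoose_mul_qPoch a d
      have h6 := qChoose_mul_qPoch c b
      rw [show a + b + (c + d) = a + b + c + d by ring] at h1
      rw [show b + c + (a + d) = a + b + c + d by ring] at h4
      rw [show c + b = b + c by ring] at h6
      refine mul_right_cancel₀ (mul_ne_zero (mul_ne_zero (qPoch_ne_zero a) (qPoch_ne_zero b))
        (mul_ne_zero (qPoch_ne_zero c) (qPoch_ne_zero d))) ?_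
      calc _ = qChoose (a + b + c + d) (a + b) * ((qChoose (a + b) a * (qPoch a * qPoch b)) *
              (qChoose (c + d) c * (qPoch c * qPoch d))) := by ring
        _ = qChoose (a + b + c + d) (b + c) * ((qChoose (b + c) c * (qPoch c * qPoch b)) *
              (qChoose (a + d) a * (qPoch a * qPoch d))) := by rw [h2, h3, h1, h6, h5, h4]
        _ = _ := by ring
    have := congrArg ofPoly key
    simpa only [map_mul, ← qb_natCast, Nat.cast_add] using this
  · have hl : qb (a + b + c + d) (a + b) * qb (a + b) a * qb (c + d) c = 0 := by
      by_cases h1 : 0 ≤ a ∧ a ≤ a + b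
      · rw [qb_eq_zero (A := c + d) (by omega), mul_zero]
      · rw [qb_eq_zero h1, mul_zero, zero_mul]
    have hr : qb (a + b + c + d) (b + c) * qb (a + d) a * qb (b + c) c = 0 := by
      by_cases h1 : 0 ≤ a ∧ a ≤ a + d
      · rw [qb_eq_zero (A := b + c) (by omega), mul_zero]
      · rw [qb_eq_zero h1, mul_zero, zero_mul]
    rw [hl, hr]

/-- The `q`-Chu–Vandermonde sum, by induction on `A` through the `q`-Pascal rule. The exponent
`(A-i)(h-i)` is rational-valued here, so `i` may range over all integers. -/
theorem qb_vandermonde (A : ℕ) {B : ℤ} (hB : 0 ≤ B) (h : ℤ) :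
    qb (A + B) h = ∑ᶠ i : ℤ, qPow ((A - i) * (h - i)) * qb A i * qb B (h - i) := by
  have fin : ∀ (A : ℤ) (c : ℤ) (f g : ℤ → QExp),
      (Function.support fun i => f i * qb A (i - c) * g i).Finite := fun A c f g => by
    refine (Set.finite_Icc c (A + c)).subset fun i hi => ?_
    by_contra h'
    exact hi (by simp only [qb_eq_zero (A := A) (B := i - c)
      (by rw [Set.mem_Icc] at h'; omega), mul_zero, zero_mul])
  induction A generalizing h with
  | zero =>
    rw [finsum_eq_single _ 0 fun i hi => ?_]
    · simp [qb_zero_zero, qPow_zero]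
    · rw [qb_eq_zero (A := ((0 : ℕ) : ℤ)) (by push_cast; omega), mul_zero, zero_mul]
  | succ A ih =>
    have hterm : ∀ i : ℤ, qPow (((A + 1 : ℕ) - i) * (h - i)) * qb (A + 1 : ℕ) i * qb B (h - i) =
        qPow (((A + 1 : ℕ) - i) * (h - i)) * qb A (i - 1) * qb B (h - i) +
        qPow h * (qPow ((A - i) * (h - i)) * qb A (i - 0) * qb B (h - i)) := fun i => by
      have e : qPow (((A + 1 : ℕ) - i) * (h - i)) * qPow i =
          qPow h * qPow ((A - i) * (h - i)) := by
        rw [← qPow_add, ← qPow_add]; congr 1; push_cast; ring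
      rw [qb_pascal (by push_cast; omega), sub_zero]
      push_cast at e ⊢
      rw [add_sub_cancel_right]
      linear_combination qb A i * qb B (h - i) * e
    rw [finsum_congr hterm, finsum_add_distrib (fin _ 1 _ _)
      ((fin A 0 (fun i => qPow h * qPow ((A - i) * (h - i))) _).subset fun i hi => by
        simpa only [mul_assoc] using hi),
      ← mul_finsum' _ _ (fin A 0 _ _), qb_pascal (by push_cast; omega)]
    simp only [sub_zero]
    rw [← ih h]
    congr 1
    · rw [← finsum_comp_equiv (Equiv.addRight (1 : ℤ)), show ((A + 1 : ℕ) : ℤ) + B - 1 = A + B by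
        push_cast; ring, ih (h - 1)]
      refine finsum_congr fun i => ?_
      simp only [Equiv.coe_addRight, add_sub_cancel_right]
      rw [show h - 1 - i = h - (i + 1) by ring]
      congr 3
      push_cast; ring
    · congr 2; push_cast; ring

/-! ### The positive transformation doubling the lower entry -/

/-- A product of two Gaussian polynomials with the same upper entry expands positively in central
ones. After the factor `[L, m+k+d]` is split off, this is the `q`-Chu–Vandermonde sum for
`[L, m-k]`. -/
theorem qb_mul_qb_eq_finsum (L : ℕ) (d m k : ℤ) :
    qPow (k * (k + d)) * (qb L (m - k) * qb L (m + k + d)) =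
      ∑ᶠ n : ℤ, qPow (n * (n + d)) * qb L (2 * n + d) * qb (L - 2 * n - d) (m - n) *
        qb (2 * n + d) (n - k) := by
  have hterm : ∀ n : ℤ, qPow (n * (n + d)) * qb L (2 * n + d) * qb (L - 2 * n - d) (m - n) *
      qb (2 * n + d) (n - k) = qPow (k * (k + d)) * qb L (m + k + d) *
        (qPow ((n + k + d) * (n - k)) * qb (m + k + d) (m - n) *
          qb (L - (m + k + d)) (n - k)) := fun n => by
    have h := qb_multinomial (m - n) (n + k + d) (n - k) (L - m - n - d)
    rw [show m - n + (n + k + d) + (n - k) + (L - m - n - d) = L by ring,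
      show m - n + (n + k + d) = m + k + d by ring,
      show n - k + (L - m - n - d) = L - (m + k + d) by ring,
      show n + k + d + (n - k) = 2 * n + d by ring,
      show m - n + (L - m - n - d) = L - 2 * n - d by ring] at h
    have e : qPow ((n : ℚ) * (n + d)) =
        qPow ((k : ℚ) * (k + d)) * qPow (((n : ℚ) + k + d) * (n - k)) := by
      rw [← qPow_add]; congr 1; ring
    rw [e]
    linear_combination -(qPow ((k : ℚ) * (k + d)) * qPow (((n : ℚ) + k + d) * (n - k))) * h
  rw [finsum_congr hterm]
  by_cases hA : 0 ≤ m + k + d ∧ m + k + d ≤ L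
  · obtain ⟨A, hA'⟩ : ∃ A : ℕ, m + k + d = A := ⟨(m + k + d).toNat, by omega⟩
    rw [hA', show (L : ℤ) - A = L - A by rfl]
    have hv := qb_vandermonde A (B := L - A) (by omega) (m - k)
    rw [← finsum_comp_equiv (Equiv.subLeft m), add_sub_cancel] at hv
    rw [mul_comm (qb _ _), ← mul_assoc, hv, ← mul_finsum']
    · congr 1
      refine finsum_congr fun n => ?_
      have e : (A : ℚ) = m + k + d := by exact_mod_cast hA'.symm
      simp only [Equiv.subLeft_apply]
      rw [show m - k - (m - n) = n - k by ring]
      congr 3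
      rw [e]; push_cast; ring
    · refine (Set.finite_Icc (m - A) m).subset fun n hn => ?_
      by_contra h'
      exact hn (by simp only [qb_eq_zero (A := A) (B := m - n)
        (by rw [Set.mem_Icc] at h'; omega), mul_zero, zero_mul])
  · simp [qb_eq_zero hA]

/-- The `q`-Chu–Vandermonde sum for `[2L, L-2k-d]`, centred. -/
theorem qb_two_mul_eq_finsum (L : ℕ) (d k : ℤ) :
    qPow (k * (k + d)) * qb (2 * L) (L - 2 * k - d) =
      ∑ᶠ m : ℤ, qPow (m * (m + d)) * (qb L (m - k) * qb L (m + k + d)) := by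
  have hv := qb_vandermonde L (B := L) (by omega) (L - 2 * k - d)
  rw [← finsum_comp_equiv (Equiv.subLeft (L - k - d)), ← two_mul] at hv
  rw [hv, mul_finsum']
  · refine finsum_congr fun m => ?_
    simp only [Equiv.subLeft_apply]
    rw [show (L : ℤ) - 2 * k - d - (L - k - d - m) = m - k by ring,
      ← qb_symm L (L - k - d - m), show (L : ℤ) - (L - k - d - m) = m + k + d by ring,
      mul_assoc, ← mul_assoc, ← qPow_add, mul_comm (qb _ _)]
    congr 2
    push_cast; ring
  · refine (Set.finite_Icc (-k - d) (L - k - d)).subset fun m hm => ?_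
    by_contra h'
    exact hm (by simp only [Equiv.subLeft_apply, qb_eq_zero (A := L) (B := L - k - d - m)
        (by rw [Set.mem_Icc] at h'; omega), mul_zero, zero_mul])

/-- The coefficient of `[2n+d, n-k]` in the expansion `qb_doubling`. -/
noncomputable def kernel (L : ℕ) (d n : ℤ) : QExp :=
  ∑ m ∈ Finset.Icc (0 : ℤ) L, qPow (m * (m + d)) *
    (qPow (n * (n + d)) * qb L (2 * n + d) * qb (L - 2 * n - d) (m - n))

theorem kernel_mem_nonneg (L : ℕ) (d n : ℤ) : kernel L d n ∈ nonneg :=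
  sum_mem fun _ _ => mul_mem (qPow_mem_nonneg _)
    (mul_mem (mul_mem (qPow_mem_nonneg _) (qb_mem_nonneg _ _)) (qb_mem_nonneg _ _))

/-- The Gaussian polynomial `[2L, L-2k-d]` with `d = 0` or `1`, multiplied by `q^{2k(k+d)}`, is a
combination of the `[2n+d, n-k]` whose coefficients are nonnegative and independent of `k`. -/
theorem qb_doubling (L : ℕ) {d : ℤ} (hd : d = 0 ∨ d = 1) (k : ℤ) :
    qPow (2 * (k * (k + d))) * qb (2 * L) (L - 2 * k - d) =
      ∑ n ∈ Finset.Icc (0 : ℤ) L, kernel L d n * qb (2 * n + d) (n - k) := by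
  have hm : qPow (k * (k + d)) * qb (2 * L) (L - 2 * k - d) = ∑ m ∈ Finset.Icc (0 : ℤ) L,
      qPow (m * (m + d)) * (qb L (m - k) * qb L (m + k + d)) := by
    rw [qb_two_mul_eq_finsum]
    refine finsum_eq_sum_of_support_subset _ fun m hm => ?_
    by_contra h
    rw [Finset.mem_coe, Finset.mem_Icc] at h
    by_cases h1 : 0 ≤ m - k ∧ m - k ≤ L
    · exact hm (by simp only [qb_eq_zero (B := m + k + d) (A := L) (by omega), mul_zero])
    · exact hm (by simp only [qb_eq_zero h1, mul_zero, zero_mul])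
  rw [two_mul, qPow_add, mul_assoc, hm, Finset.mul_sum]
  simp only [kernel, Finset.sum_mul]
  rw [Finset.sum_comm]
  refine Finset.sum_congr rfl fun m _ => ?_
  rw [mul_left_comm, qb_mul_qb_eq_finsum, finsum_eq_sum_of_support_subset (s := Finset.Icc (0 : ℤ) L),
    Finset.mul_sum]
  · exact Finset.sum_congr rfl fun n _ => by ring
  · intro n hn
    by_contra h
    rw [Finset.mem_coe, Finset.mem_Icc] at h
    by_cases h1 : 0 ≤ 2 * n + d ∧ 2 * n + d ≤ L
    · omega
    · exact hn (by simp only [qb_eq_zero h1, mul_zero, zero_mul])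

/-! ### Alternating sums of Gaussian polynomials -/

/-- The alternating sum `∑_{j ∈ ℤ} (-1)^j q^{e(j)} [A, B-Kj]`. -/
noncomputable def altSum (A B : ℤ) (K : ℕ) (e : ℤ → ℚ) : QExp :=
  ∑ᶠ j : ℤ, ((j.negOnePow : ℤ) : QExp) * qPow (e j) * qb A (B - K * j)

theorem G_eq_altSum (N M : ℤ) (α β : ℚ) (K : ℕ) :
    G N M α β K = altSum (N + M) N K fun j => K * j * (((α + β) * j + (α - β)) / 2) :=
  rfl

theorem finite_support_qb (A B : ℤ) {K : ℕ} (hK : 0 < K) (f : ℤ → QExp) :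
    (Function.support fun j : ℤ => f j * qb A (B - K * j)).Finite :=
  finite_support_qBinom A B K hK f

theorem altSum_add_const (A B : ℤ) {K : ℕ} (hK : 0 < K) (e : ℤ → ℚ) (c : ℚ) :
    altSum A B K (fun j => e j + c) = qPow c * altSum A B K e := by
  rw [altSum, altSum, mul_finsum' _ _ (finite_support_qb A B hK _)]
  exact finsum_congr fun j => by rw [qPow_add]; ring

/-- Summation of `qb_doubling` against the alternating weights. -/
theorem altSum_doubling_mem_nonneg {d c : ℤ} (hd : d = 0 ∨ d = 1) {K : ℕ} (hK : 0 < K)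
    (e : ℤ → ℚ) (h : ∀ L : ℕ, altSum (2 * L + d) (L - c) K e ∈ nonneg) (L : ℕ) :
    altSum (2 * L) (L - 2 * c - d) (2 * K)
      (fun j => e j + 2 * ((c + K * j) * (c + K * j + d))) ∈ nonneg := by
  have hterm : ∀ j : ℤ, ((j.negOnePow : ℤ) : QExp) *
      qPow (e j + 2 * ((c + K * j) * (c + K * j + d))) *
        qb (2 * L) (L - 2 * c - d - (2 * K : ℕ) * j) =
      ∑ n ∈ Finset.Icc (0 : ℤ) L, kernel L d n * (((j.negOnePow : ℤ) : QExp) *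
        qPow (e j) * qb (2 * n + d) (n - c - K * j)) := fun j => by
    have hq := qb_doubling L hd (c + K * j)
    rw [show (L : ℤ) - 2 * (c + K * j) - d = L - 2 * c - d - (2 * K : ℕ) * j by push_cast; ring]
      at hq
    push_cast at hq ⊢
    rw [qPow_add, mul_assoc, mul_assoc, hq, Finset.mul_sum, Finset.mul_sum]
    exact Finset.sum_congr rfl fun n _ => by rw [sub_sub]; ring
  have fin : ∀ n : ℤ, (Function.support fun j : ℤ => ((j.negOnePow : ℤ) : QExp) *
      qPow (e j) * qb (2 * n + d) (n - c - K * j)).Finite :=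
    fun n => finite_support_qb _ _ hK _
  rw [altSum, finsum_congr hterm, finsum_sum_comm]
  · refine sum_mem fun n hn => ?_
    rw [← mul_finsum' _ _ (fin n)]
    refine mul_mem (kernel_mem_nonneg L d n) ?_
    rw [Finset.mem_Icc] at hn
    have := h n.toNat
    rwa [Int.toNat_of_nonneg hn.1] at this
  · exact fun n _ => (fin n).subset fun j hj h0 => hj (by
      simp only at h0 ⊢
      rw [h0, mul_zero])

/-! ### Bressoud polynomials with integer parameters -/

theorem G_symm (N M : ℤ) (α β : ℚ) (K : ℕ) : G N M α β K = G M N β α K := by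
  rw [G_eq_altSum, G_eq_altSum, altSum, altSum, ← finsum_comp_equiv (Equiv.neg ℤ)]
  refine finsum_congr fun j => ?_
  simp only [Equiv.neg_apply, Int.negOnePow_neg]
  rw [← qb_symm (N + M), show N + M - (N - K * -j) = M - K * j by ring, add_comm N M]
  congr 3
  push_cast; ring

/-- The `q`-Pascal rule for Bressoud polynomials. -/
theorem G_pascal {N M : ℤ} (h : 1 ≤ N + M) (α β : ℚ) {K : ℕ} (hK : 0 < K) :
    G N M α β K = G (N - 1) M α β K + qPow N * G N (M - 1) (α - 1) (β + 1) K := by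
  simp only [G_eq_altSum, altSum]
  rw [mul_finsum' _ _ (finite_support_qb _ _ hK _), ← finsum_add_distrib
    (finite_support_qb _ _ hK _) ((finite_support_qb (N + (M - 1)) N hK
      fun j => qPow N * (((j.negOnePow : ℤ) : QExp) *
        qPow (K * j * (((α - 1 + (β + 1)) * j + (α - 1 - (β + 1))) / 2)))).subset
      fun j hj => by simpa only [mul_assoc] using hj)]
  refine finsum_congr fun j => ?_
  have e : qPow (K * j * (((α + β) * j + (α - β)) / 2)) * qPow (N - K * j : ℤ) =
      qPow N * qPow (K * j * (((α - 1 + (β + 1)) * j + (α - 1 - (β + 1))) / 2)) := by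
    rw [← qPow_add, ← qPow_add]; congr 1; push_cast; ring
  rw [qb_pascal h, show N + M - 1 = N - 1 + M by ring, show N + (M - 1) = N - 1 + M by ring,
    show N - K * j - 1 = N - 1 - K * j by ring]
  linear_combination ((j.negOnePow : ℤ) : QExp) * qb (N - 1 + M) (N - K * j) * e

theorem G_pascal' {N M : ℤ} (h : 1 ≤ N + M) (α β : ℚ) {K : ℕ} (hK : 0 < K) :
    G N M α β K = G N (M - 1) α β K + qPow M * G (N - 1) M (α + 1) (β - 1) K := by
  rw [G_symm, G_pascal (by omega) _ _ hK, G_symm (M - 1), G_symm M (N - 1)]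

/-- On the boundary of the range of positivity the terms with indices `j` and `-1 - j` cancel. -/
theorem G_eq_zero {N M : ℤ} {K : ℕ} (h : M = N + K) (α : ℚ) : G N M α 0 K = 0 := by
  have key : G N M α 0 K = -G N M α 0 K := by
    conv_lhs => rw [G_eq_altSum, altSum, ← finsum_comp_equiv (Equiv.subLeft (-1 : ℤ))]
    rw [G_eq_altSum, altSum, ← finsum_neg_distrib]
    refine finsum_congr fun j => ?_
    have hs : ((-1 - j).negOnePow : ℤ) = -(j.negOnePow : ℤ) := by
      rw [Int.negOnePow_sub]; simp
    simp only [Equiv.subLeft_apply, hs]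
    rw [← qb_symm (N + M), show N + M - (N - K * (-1 - j)) = N - K * j by rw [h]; ring,
      Int.cast_neg, neg_mul, neg_mul]
    congr 4
    push_cast; ring
  ext e
  have := congrArg (fun P => P.coeff e) key
  simp only [AddMonoidAlgebra.coeff_neg, Finsupp.neg_apply] at this
  simp only [AddMonoidAlgebra.coeff_zero, Finsupp.zero_apply]
  omega

/-- Positivity of the Bressoud polynomials with integer parameters `α` and `β`. The two `q`-Pascal
rules lower `N + M` and keep `α + β`; inside the range one of them stays in the range, and where
both leave it the polynomial vanishes. -/
theorem G_mem_nonneg {K : ℕ} {α β : ℤ} (hα : 0 ≤ α) (hβ : 0 ≤ β) (h1 : 1 ≤ α + β)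
    (h2 : α + β ≤ 2 * K - 1) {N M : ℤ} (hl : β - K ≤ N - M) (hu : N - M ≤ K - α) :
    G N M α β K ∈ nonneg := by
  have hK : 0 < K := by omega
  induction hs : (N + M).toNat generalizing N M α β with
  | zero =>
    rw [G_eq_altSum, altSum, finsum_eq_single _ 0 fun j hj => ?_]
    -- for `N + M ≤ 0` only the index `j = 0` can contribute
    · simpa [qPow_zero] using qb_mem_nonneg _ _
    · rw [qb_eq_zero, mul_zero]
      rintro ⟨ha, hb⟩
      have hK' : (0 : ℤ) < K := by omega
      rcases lt_or_gt_of_ne hj with hj | hj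
      · have : (K : ℤ) * j ≤ K * (-1) := by gcongr; omega
        omega
      · have : (K : ℤ) * 1 ≤ K * j := by gcongr; omega
        omega
  | succ s ih =>
    have hNM : 1 ≤ N + M := by omega
    -- the two recurrences, each under the condition that its two terms are in the range
    have ha : 1 ≤ α → β - K + 1 ≤ N - M → G N M α β K ∈ nonneg := fun hα' hl' => by
      rw [G_pascal hNM _ _ hK]
      refine add_mem (ih hα hβ h1 h2 (by omega) (by omega) (by omega))
        (mul_mem (qPow_mem_nonneg _) ?_)
      have := ih (α := α - 1) (β := β + 1) (N := N) (M := M - 1) (by omega) (by omega) (by omega)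
        (by omega) (by omega) (by omega) (by omega)
      push_cast at this
      exact this
    have hb : 1 ≤ β → N - M + 1 ≤ K - α → G N M α β K ∈ nonneg := fun hβ' hu' => by
      rw [G_pascal' hNM _ _ hK]
      refine add_mem (ih hα hβ h1 h2 (by omega) (by omega) (by omega))
        (mul_mem (qPow_mem_nonneg _) ?_)
      have := ih (α := α + 1) (β := β - 1) (N := N - 1) (M := M) (by omega) (by omega) (by omega)
        (by omega) (by omega) (by omega) (by omega)
      push_cast at this
      exact this
    rcases hα.eq_or_lt with rfl | hα'
    · rcases eq_or_ne (N - M) K with h | h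
      · rw [G_symm, Int.cast_zero, G_eq_zero (by omega)]
        exact zero_mem _
      · exact hb (by omega) (by omega)
    · rcases hl.eq_or_lt with h | h
      · rcases hβ.eq_or_lt with rfl | hβ'
        · rw [Int.cast_zero, G_eq_zero (by omega)]
          exact zero_mem _
        · exact hb (by omega) (by omega)
      · exact ha (by omega) (by omega)

/-! ### The doubling hierarchy -/

/-- The exponent in the written-out form of the sum. -/
def hierExp (v n : ℕ) (j : ℤ) : ℚ :=
  (v : ℚ) * (2 * (((4 : ℚ) ^ n - 1) / 3) * v + 1) * (j : ℚ) ^ 2 + ((4 : ℚ) ^ n - 1) / 3 * v * j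

theorem altSum_hierExp_mem_nonneg {v : ℕ} (hv : 0 < v) (m L : ℕ) :
    altSum (2 * L) (L - 2 ^ m) (2 ^ (m + 2) * v) (hierExp v (m + 2)) ∈ nonneg := by
  -- a constant shift of the exponents is a factor with nonnegative coefficients
  have shift : ∀ {A B : ℤ} {K : ℕ}, 0 < K → ∀ {e e' : ℤ → ℚ} (c : ℚ), (∀ j, e' j = e j + c) →
      altSum A B K e ∈ nonneg → altSum A B K e' ∈ nonneg := fun hK e e' c he h => by
    rw [show e' = fun j => e j + c from funext he, altSum_add_const _ _ hK]
    exact mul_mem (qPow_mem_nonneg _) h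
  induction m generalizing L with
  | zero =>
    have h := altSum_doubling_mem_nonneg (d := 1) (c := 0) (Or.inr rfl) (K := 2 * v) (by omega)
      (fun j => (2 * v : ℕ) * j * (((((v + 1 : ℤ) : ℚ) + (v : ℤ)) * j +
        (((v + 1 : ℤ) : ℚ) - (v : ℤ))) / 2)) (fun L => by
        have h := G_mem_nonneg (K := 2 * v) (α := v + 1) (β := v) (N := L) (M := L + 1) (by omega)
          (by omega) (by omega) (by push_cast; omega) (by push_cast; omega) (by push_cast; omega)
        rw [G_eq_altSum] at h
        rwa [sub_zero, two_mul, add_assoc]) L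
    rw [show (L : ℤ) - 2 * 0 - 1 = L - 2 ^ 0 by ring,
      show 2 * (2 * v) = 2 ^ (0 + 2) * v by ring] at h
    refine shift (by positivity) 0 (fun j => ?_) h
    simp only [hierExp]
    push_cast
    ring
  | succ m ih =>
    have h := altSum_doubling_mem_nonneg (d := 0) (c := 2 ^ m) (Or.inl rfl)
      (K := 2 ^ (m + 2) * v) (by positivity) _ (fun L => by simpa using ih L) L
    rw [show (L : ℤ) - 2 * 2 ^ m - 0 = L - 2 ^ (m + 1) by ring,
      show 2 * (2 ^ (m + 2) * v) = 2 ^ (m + 1 + 2) * v by ring] at h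
    refine shift (by positivity) (-(2 * (2 ^ m) ^ 2)) (fun j => ?_) h
    have e : (4 : ℚ) ^ m = 2 ^ m * 2 ^ m := by rw [← mul_pow]; norm_num
    simp only [hierExp]
    push_cast
    simp only [pow_succ, e]
    ring

/-- Here `(4^n - 1) / 3` is an integer, and the exponents are nonnegative. -/
theorem hierExp_eq_natCast (v n : ℕ) (j : ℤ) : ∃ k : ℕ, hierExp v n j = k := by
  obtain ⟨D, hD⟩ : 3 ∣ 4 ^ n - 1 := by simpa using Nat.sub_dvd_pow_sub_pow 4 1 n
  have hD' : ((4 : ℚ) ^ n - 1) / 3 = D := by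
    have : (4 : ℚ) ^ n = 3 * D + 1 := by
      have : 4 ^ n = 3 * D + 1 := by have := Nat.one_le_pow n 4 (by norm_num); omega
      exact_mod_cast this
    rw [this]; ring
  -- the linear term is controlled by `x² + x ≥ 0` for the integer `x = v j`
  have hnn : 0 ≤ (v : ℤ) * (2 * D * v + 1) * j ^ 2 + D * v * j := by
    have h1 : 0 ≤ D * ((v : ℤ) * j) ^ 2 := by positivity
    have h2 : 0 ≤ (D : ℤ) * ((v * j) ^ 2 + v * j) := by
      refine mul_nonneg (by positivity) ?_
      nlinarith [Int.le_self_sq (-(v * j : ℤ))]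
    have h3 : 0 ≤ (v : ℤ) * j ^ 2 := by positivity
    nlinarith
  refine ⟨((v : ℤ) * (2 * D * v + 1) * j ^ 2 + D * v * j).toNat, ?_⟩
  have := congrArg (fun z : ℤ => (z : ℚ)) (Int.toNat_of_nonneg hnn)
  push_cast at this
  rw [hierExp, hD', this]

theorem altSum_mem_range_ofPoly (A B : ℤ) (K : ℕ) {e : ℤ → ℚ} (he : ∀ j, ∃ k : ℕ, e j = k) :
    altSum A B K e ∈ ofPoly.range := by
  refine finsum_induction (· ∈ ofPoly.range) (zero_mem _) (fun _ _ => add_mem) fun j => ?_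
  obtain ⟨k, hk⟩ := he j
  rw [hk, ← ofPoly_X_pow]
  exact mul_mem (mul_mem (intCast_mem _ _) ⟨_, rfl⟩) ⟨_, rfl⟩

end BressoudPos

theorem theoremT4p5 (v n : ℕ) (hv : 2 ≤ v) (hn : 2 ≤ n) (L : ℕ) :
    BressoudPos.NonnegCoeffs
      (BressoudPos.G ((L : ℤ) - 2 ^ (n - 2)) ((L : ℤ) + 2 ^ (n - 2))
        (2 * (v : ℚ) * (((2 : ℚ) ^ n - (2 : ℚ) ^ (-(n : ℤ))) / 3)
          + ((2 : ℚ) ^ n + (2 : ℚ) ^ (1 - (n : ℤ))) / 3)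
        (2 * (v : ℚ) * (((2 : ℚ) ^ n - (2 : ℚ) ^ (-(n : ℤ))) / 3)
          + ((2 : ℚ) ^ (2 - (n : ℤ)) - (2 : ℚ) ^ n) / 3)
        (2 ^ n * v)) ∧
    BressoudPos.NonnegCoeffs
      (∑ᶠ j : ℤ, ((j.negOnePow : ℤ) : BressoudPos.QExp) *
        BressoudPos.qPow ((v : ℚ) * (2 * (((4 : ℚ) ^ n - 1) / 3) * v + 1) * (j : ℚ) ^ 2
          + ((4 : ℚ) ^ n - 1) / 3 * v * j) *
        BressoudPos.ofPoly
          (BressoudPos.qBinom (2 * (L : ℤ)) ((L : ℤ) - 2 ^ (n - 2) - 2 ^ n * (v : ℤ) * j))) := by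
  have main : BressoudPos.NonnegCoeffs (BressoudPos.altSum (2 * L) (L - 2 ^ (n - 2)) (2 ^ n * v)
      (BressoudPos.hierExp v n)) := by
    obtain ⟨m, rfl⟩ := Nat.exists_eq_add_of_le' hn
    exact BressoudPos.nonnegCoeffs_of_mem
      (BressoudPos.altSum_hierExp_mem_nonneg (by omega) m L)
      (BressoudPos.altSum_mem_range_ofPoly _ _ _ (BressoudPos.hierExp_eq_natCast v _))
  constructor
  · convert main using 1
    rw [BressoudPos.G_eq_altSum, show (L : ℤ) - 2 ^ (n - 2) + (L + 2 ^ (n - 2)) = 2 * L by ring]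
    congr 1
    funext j
    have h2 : (2 : ℚ) ^ n ≠ 0 := by positivity
    have h4 : (4 : ℚ) ^ n = 2 ^ n * 2 ^ n := by rw [← mul_pow]; norm_num
    rw [BressoudPos.hierExp, h4, zpow_sub₀ two_ne_zero, zpow_sub₀ two_ne_zero, zpow_neg,
      zpow_natCast]
    push_cast
    field_simp
    ring
  · convert main using 1
    refine finsum_congr fun j => ?_
    rw [BressoudPos.hierExp, BressoudPos.qb]
    push_cast
    rfl
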